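/- Let $(M,g)$ be an $n$-dimensional smooth Riemannian manifold (without boundary) and let $k,p\in\mathbb N$ with $k>0$, $p>1$, $k+p<n-1$. Let $U\subseteq M$ be open, let $h_1,\dots,h_p\in C^\infty(U,\mathbb R)$ be functions none of which is identically zero, and let $X_1,\dots,X_k,Y_1,\dots,Y_p\in\mathfrak X(U)$ be smooth vector fields whose values are linearly independent at every point of $U$. Each exterior power $\Lambda^mT_xM$ carries the inner product with $\langle v_1\wedge\dots\wedge v_m,w_1\wedge\dots\wedge w_m\rangle_m=\det[g_x(v_i,w_j)]$ and its norm $\|\cdot\|_m$. For each $x\in U$ choose a unit $n$-vector $\mu_x\in\Lambda^nT_xM$ (no continuity in $x$ is required), and let $\star=\star_x:\Lambda^mT_xM\to\Lambda^{n-m}T_xM$ be the corresponding Hodge star, defined by $\langle\star\nu,\omega\rangle_{n-m}\,\mu_x=\nu\wedge\omega$; $\Lambda^1T_xM$ is identified with $T_xM$. On $U$ put $$X_0=\Big\|\bigwedge_{i=1}^pY_i\wedge\bigwedge_{j=1}^kX_j\Big\|_{k+p}^{-2}\sum_{i=1}^p(-1)^{n-i}h_i\,\Theta_i,\qquad \Theta_i=\star\Big[\bigwedge_{j=1,\,j\ne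 i}^pY_j\wedge\bigwedge_{l=1}^kX_l\wedge\star\Big(\bigwedge_{j=1}^pY_j\wedge\bigwedge_{l=1}^kX_l\Big)\Big].$$ Then: 1. $X_0\in\mathfrak X(U)$, and a vector field $X\in\mathfrak X(U)$ satisfies $g(X,X_1)=\dots=g(X,X_k)=0$ and $g(X,Y_1)=h_1,\dots,g(X,Y_p)=h_p$ on $U$ if and only if $X=X_0+X_\perp$ for some $X_\perp\in\mathfrak X(U)$ with $X_\perp(x)\in\operatorname{span}_{\mathbb R}\{X_1(x),\dots,X_k(x),Y_1(x),\dots,Y_p(x)\}^{\perp_{g(x)}}$ for every $x\in U$. 2. Every $x\in U$ has an open neighbourhood $U_x\subseteq U$ on which there are smooth vector fields $Z_1,\dots,Z_{n-(k+p)}$ such that $X_1,\dots,X_k,Y_1,\dots,Y_p,Z_1,\dots,Z_{n-(k+p)}$ is a moving frame on $U_x$ (smooth vector fields forming a basis of the tangent space at every point). Moreover, for every open $O\subseteq U$, for arbitrary $Z_1,\dots,Z_{n-(k+p)}\in\mathfrak X(O)$ completing $X_1,\dots,X_k,Y_1,\dots,Y_p$ to a moving frame on $O$, and for every $x'\in O$,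 $$\operatorname{span}_{\mathbb R}\{X_1(x'),\dots,X_k(x'),Y_1(x'),\dots,Y_p(x')\}^{\perp_{g(x')}}=\operatorname{span}_{\mathbb R}\Big\{\star_{x'}\Big(\bigwedge_{i=1,\,i\ne a}^{n-(k+p)}Z_i(x')\wedge\bigwedge_{j=1}^pY_j(x')\wedge\bigwedge_{l=1}^kX_l(x')\Big):1\le a\le n-(k+p)\Big\};$$ in particular, $X_\perp(x')$ lies in the right-hand span for every $X_\perp$ as in 1. -/

import Mathlib

open scoped Manifold ContDiff Bundle

noncomputable section

namespace HodgeSystem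

section Linear

variable {V : Type*} [NormedAddCommGroup V] [InnerProductSpace ℝ V]

/-- The exterior product `Λᵃ V × Λᵇ V → Λᶜ V`, `c = a + b`. The target degree is a separate
parameter, so that no casts between equal degrees are needed. -/
def wedge {a b c : ℕ} (h : a + b = c) : ⋀[ℝ]^a V →ₗ[ℝ] ⋀[ℝ]^b V →ₗ[ℝ] ⋀[ℝ]^c V :=
  LinearMap.mk₂ ℝ
    (fun ν η ↦ ⟨(ν : ExteriorAlgebra ℝ V) * (η : ExteriorAlgebra ℝ V),
      h ▸ SetLike.mul_mem_graded ν.2 η.2⟩)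
    (fun ν₁ ν₂ η ↦ Subtype.ext (by simp [add_mul]))
    (fun r ν η ↦ Subtype.ext (by simp))
    (fun ν η₁ η₂ ↦ Subtype.ext (by simp [mul_add]))
    (fun r ν η ↦ Subtype.ext (by simp))

@[simp]
theorem coe_wedge {a b c : ℕ} (h : a + b = c) (ν : ⋀[ℝ]^a V) (η : ⋀[ℝ]^b V) :
    (wedge h ν η : ExteriorAlgebra ℝ V) = (ν : ExteriorAlgebra ℝ V) * η := rfl

/-- The decomposable multivector `v₁ ∧ ⋯ ∧ vₘ`. -/
def blade {m : ℕ} (v : Fin m → V) : ⋀[ℝ]^m V := exteriorPower.ιMulti ℝ m v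

/-- The decomposable multivector `v₁ ∧ ⋯ ∧ vₘ` with the factor `vᵢ` left out (the remaining
factors are kept in increasing order). -/
def bladeOmit {m : ℕ} (v : Fin m → V) (i : Fin m) : ⋀[ℝ]^(m - 1) V :=
  exteriorPower.ιMulti_family ℝ (m - 1) v
    (Set.powersetCard.ofCard (s := Finset.univ.erase i) (by simp))

variable [FiniteDimensional ℝ V]

/-- The Hodge star `Λᵃ V → Λᵇ V`, `a + b = n`, with respect to the volume element `μ ∈ Λⁿ V`:
`⋆ν` is the Riesz representative of the functional `η ↦ ⟪μ, ν ∧ η⟫` on `Λᵇ V`. If `n = dim V` and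
`μ` is a unit `n`-vector, `⟪μ, ν ∧ η⟫` is the coefficient of `ν ∧ η` along `μ`, so that
`⟪⋆ν, η⟫ μ = ν ∧ η`; see `inner_hodgeStar_smul`. -/
def hodgeStar {n a b : ℕ} (μ : ⋀[ℝ]^n V) (h : a + b = n) : ⋀[ℝ]^a V →ₗ[ℝ] ⋀[ℝ]^b V :=
  (InnerProductSpace.toDual ℝ (⋀[ℝ]^b V)).symm.toLinearEquiv.toLinearMap ∘ₗ
    (LinearMap.toContinuousLinearMap (𝕜 := ℝ) (E := ⋀[ℝ]^b V) (F' := ℝ)).toLinearMap ∘ₗ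
      (innerₗ (⋀[ℝ]^n V) μ).compRight ℝ ∘ₗ wedge h

theorem inner_hodgeStar {n a b : ℕ} (μ : ⋀[ℝ]^n V) (h : a + b = n)
    (ν : ⋀[ℝ]^a V) (η : ⋀[ℝ]^b V) :
    inner ℝ (hodgeStar μ h ν) η = inner ℝ μ (wedge h ν η) := by
  simp [hodgeStar]

/-- The defining property of the Hodge star. -/
theorem inner_hodgeStar_smul {n a b : ℕ} (hn : Module.finrank ℝ V = n) (μ : ⋀[ℝ]^n V)
    (hμ : ‖μ‖ = 1) (h : a + b = n) (ν : ⋀[ℝ]^a V) (η : ⋀[ℝ]^b V) :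
    (inner ℝ (hodgeStar μ h ν) η : ℝ) • μ = wedge h ν η := by
  have h1 : Module.finrank ℝ (⋀[ℝ]^n V) = 1 := by
    rw [exteriorPower.finrank_eq, hn, Nat.choose_self]
  have hμ0 : μ ≠ 0 := by
    rintro rfl
    simp at hμ
  obtain ⟨c, hc⟩ := (finrank_eq_one_iff_of_nonzero' μ hμ0).1 h1 (wedge h ν η)
  rw [inner_hodgeStar, ← hc, real_inner_smul_right, real_inner_self_eq_norm_sq, hμ]
  simp

/-- The vector
`Θᵢ = ⋆[⋀_{j ≠ i} Yⱼ ∧ ⋀ₗ Xₗ ∧ ⋆(⋀ⱼ Yⱼ ∧ ⋀ₗ Xₗ)] ∈ Λ¹ V = V`. -/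
def theta {n k p : ℕ} (hkp : k + p ≤ n) (μ : ⋀[ℝ]^n V) (X : Fin k → V) (Y : Fin p → V)
    (i : Fin p) : V :=
  exteriorPower.oneEquiv ℝ V <|
    hodgeStar μ (show (n - 1) + 1 = n by have := i.pos; omega) <|
      wedge (show ((p - 1) + k) + (n - (p + k)) = n - 1 by have := i.pos; omega)
        (wedge rfl (bladeOmit Y i) (blade X))
        (hodgeStar μ (show (p + k) + (n - (p + k)) = n by omega)
          (wedge rfl (blade Y) (blade X)))

/-- The vector `X₀ = ‖⋀ᵢ Yᵢ ∧ ⋀ⱼ Xⱼ‖⁻² ∑ᵢ (-1)ⁿ⁻ⁱ hᵢ Θᵢ`. In the sum the index `i : Fin p` starts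
at `0`, so the exponent for the `i`-th term is `n - (i + 1)`. -/
def particularSolution {n k p : ℕ} (hkp : k + p ≤ n) (μ : ⋀[ℝ]^n V) (X : Fin k → V)
    (Y : Fin p → V) (h : Fin p → ℝ) : V :=
  ‖wedge (rfl : p + k = p + k) (blade Y) (blade X)‖ ^ (-2 : ℤ) •
    ∑ i : Fin p, ((-1 : ℝ) ^ (n - ((i : ℕ) + 1)) * h i) • theta hkp μ X Y i

/-- The vector `⋆(⋀_{i ≠ a} Zᵢ ∧ ⋀ⱼ Yⱼ ∧ ⋀ₗ Xₗ) ∈ Λ¹ V = V`. -/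
def perpGenerator {n k p : ℕ} (μ : ⋀[ℝ]^n V) (X : Fin k → V) (Y : Fin p → V)
    (Z : Fin (n - (k + p)) → V) (a : Fin (n - (k + p))) : V :=
  exteriorPower.oneEquiv ℝ V <|
    hodgeStar μ (show (n - 1) + 1 = n by have := a.pos; omega) <|
      wedge (show ((n - (k + p) - 1) + p) + k = n - 1 by have := a.pos; omega)
        (wedge rfl (bladeOmit Z a) (blade Y)) (blade X)

end Linear

section Manifold

variable {n : ℕ} {M : Type*} [TopologicalSpace M] [ChartedSpace (EuclideanSpace ℝ (Fin n)) M]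

instance finiteDimensional_tangentSpace (x : M) :
    FiniteDimensional ℝ (TangentSpace (𝓡 n) x) :=
  inferInstanceAs (FiniteDimensional ℝ (EuclideanSpace ℝ (Fin n)))

/-- `W` restricts to a smooth vector field on `U`, i.e. `W ∈ 𝔛(U)` (its values off `U` are
irrelevant). -/
def IsSmoothFieldOn [IsManifold (𝓡 n) ∞ M] (W : (x : M) → TangentSpace (𝓡 n) x) (U : Set M) :
    Prop :=
  ContMDiffOn (𝓡 n) (𝓡 n).tangent ∞ (fun x ↦ (⟨x, W x⟩ : TangentBundle (𝓡 n) M)) U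

variable [Bundle.RiemannianBundle (fun x : M ↦ TangentSpace (𝓡 n) x)] {k p : ℕ}

/-- The vector field `X₀`, computed pointwise in `(T_x M, g_x)` with the Hodge star belonging to the
unit `n`-vector `μ x`. -/
def particularField (hkp : k + p ≤ n) (μ : (x : M) → ⋀[ℝ]^n (TangentSpace (𝓡 n) x))
    (X : Fin k → (x : M) → TangentSpace (𝓡 n) x) (Y : Fin p → (x : M) → TangentSpace (𝓡 n) x)
    (h : Fin p → M → ℝ) (x : M) : TangentSpace (𝓡 n) x :=
  particularSolution hkp (μ x) (fun l ↦ X l x) (fun i ↦ Y i x) (fun i ↦ h i x)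

/-- The orthogonal complement in `(T_x M, g_x)` of the span of all `X_l(x)` and `Y_i(x)`. -/
def perpSpace (X : Fin k → (x : M) → TangentSpace (𝓡 n) x)
    (Y : Fin p → (x : M) → TangentSpace (𝓡 n) x) (x : M) : Submodule ℝ (TangentSpace (𝓡 n) x) :=
  (Submodule.span ℝ (Set.range (fun l ↦ X l x) ∪ Set.range (fun i ↦ Y i x)))ᗮ

end Manifold

end HodgeSystem

end

open HodgeSystem

/-!
Everything is reduced to Gram matrices. Let `w = (Y₁, …, Yₚ, X₁, …, Xₖ)` and `B = ⋀ Yᵢ ∧ ⋀ Xₗ`. By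
the definition of the star, `⟪Θᵢ, v⟫` is the coefficient along `μ` of
`⋀_{j ≠ i} Yⱼ ∧ ⋀ Xₗ ∧ ⋆B ∧ v`. Moving `v` to the `i`-th place (`bladeOmit_mul_ι`) turns this into
`(-1)ⁿ⁻ⁱ B' ∧ ⋆B`, where `B'` is `B` with `Yᵢ` replaced by `v`, and as the star is isometric
(`inner_hodgeStar_hodgeStar`), `⟪Θᵢ, v⟫ = (-1)ⁿ⁻ⁱ ⟪B', B⟫` (`inner_theta`). The right-hand side is
the determinant of the Gram matrix `G` of `w` with one column replaced by the numbers `⟪wⱼ, v⟫`, so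
by Cramer's rule `(-1)ⁿ⁻ⁱ Θᵢ = ∑ⱼ adj(G)ᵢⱼ wⱼ` (`neg_one_pow_smul_theta`). Since `‖B‖² = det G`,
this gives `X₀ = ∑ᵢ hᵢ ∑ⱼ (G⁻¹)ᵢⱼ wⱼ` (`particularSolution_eq`).

This formula has two consequences. The field `X₀` is smooth, because the volume elements `μ`, which
need not be continuous, have disappeared (`isSmoothFieldOn_particularField`). And `X₀` has the
prescribed products with all `wⱼ` (`inner_particularSolution`), so the solutions differ from `X₀`
exactly by the fields orthogonal to all `wⱼ` (`solution_iff`).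

For a completion `Z` to a frame, the same rearrangement shows that `⟪⋆(⋀_{i ≠ a} Zᵢ ∧ B), v⟫` is up
to sign the coefficient along `μ` of `⋀ Zᵢ ∧ B` with `Z_a` replaced by `v`. Hence these vectors are
orthogonal to all `wⱼ` and biorthogonal to the `Z_a`, which forces them to span the orthogonal
complement (`orthogonal_eq_span_perpGenerator`). Completions exist locally since a frame at one
point, extended smoothly, has a non-zero Gram determinant nearby (`exists_isLocalFrameOn`).
-/

namespace HodgeSystem

/-! ### Exterior products of vectors -/

section Exterior

variable {V : Type*} [NormedAddCommGroup V] [InnerProductSpace ℝ V]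

theorem coe_blade {m : ℕ} (v : Fin m → V) :
    (blade v : ExteriorAlgebra ℝ V) = ExteriorAlgebra.ιMulti ℝ m v := rfl

theorem wedge_blade_blade {a b : ℕ} (u : Fin a → V) (v : Fin b → V) :
    wedge rfl (blade u) (blade v) = blade (Fin.append u v) :=
  Subtype.ext (ExteriorAlgebra.ιMulti_mul_ιMulti u v)

theorem coe_bladeOmit_succ {m : ℕ} (v : Fin (m + 1) → V) (i : Fin (m + 1)) :
    (bladeOmit v i : ExteriorAlgebra ℝ V) = ExteriorAlgebra.ιMulti ℝ m (i.removeNth v) := by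
  change ExteriorAlgebra.ιMulti ℝ m (v ∘ _) = _
  congr 2
  symm
  refine Finset.orderEmbOfFin_unique (s := Finset.univ.erase i) (by simp) (fun x ↦ ?_)
    (Fin.strictMono_succAbove i)
  simp

/-- Vectors anticommute in the exterior algebra, so moving `v` past an `a`-vector costs
`(-1)ᵃ`. -/
theorem mul_ι_eq_neg_one_pow_smul {a : ℕ} (x : ⋀[ℝ]^a V) (v : V) :
    (x : ExteriorAlgebra ℝ V) * ExteriorAlgebra.ι ℝ v =
      (-1 : ℝ) ^ a • (ExteriorAlgebra.ι ℝ v * (x : ExteriorAlgebra ℝ V)) := by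
  obtain ⟨x, hx⟩ := x
  change x * _ = _ • (_ * x)
  rw [← ExteriorAlgebra.ιMulti_span_fixedDegree] at hx
  induction hx using Submodule.span_induction with
  | mem y hy =>
    obtain ⟨w, rfl⟩ := hy
    induction a with
    | zero => simp
    | succ a ih =>
      rw [ExteriorAlgebra.ιMulti_succ_apply, mul_assoc, ih, mul_smul_comm, ← mul_assoc,
        ← mul_assoc, eq_neg_of_add_eq_zero_left (ExteriorAlgebra.ι_add_mul_swap (w 0) v),
        pow_succ]
      simp
  | zero => simp
  | add y z _ _ hy hz => rw [add_mul, hy, hz, mul_add, smul_add]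
  | smul c y _ hy => rw [smul_mul_assoc, hy, mul_smul_comm, smul_comm]

/-- A vector wedged on at the end can be moved into the slot of the omitted factor: it passes all
`n - 1` other factors, and then the `i` factors in front of that slot. -/
theorem bladeOmit_mul_ι {n m b : ℕ} (h : m + b = n) (w : Fin m → V) (i : Fin m)
    (x : ⋀[ℝ]^b V) (v : V) :
    (bladeOmit w i : ExteriorAlgebra ℝ V) * x * ExteriorAlgebra.ι ℝ v =
      (-1 : ℝ) ^ (n - ((i : ℕ) + 1)) •
        ((blade (Function.update w i v) : ExteriorAlgebra ℝ V) * x) := by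
  obtain _ | m := m
  · exact i.elim0
  have hi : Function.update w i v = i.insertNth v (i.removeNth w) := by
    rw [Fin.insertNth_removeNth]
  have h1 := mul_ι_eq_neg_one_pow_smul (wedge rfl (bladeOmit w i) x) v
  rw [coe_wedge, coe_bladeOmit_succ] at h1
  rw [coe_bladeOmit_succ, h1, coe_blade, hi, AlternatingMap.map_insertNth,
    ExteriorAlgebra.ιMulti_succ_apply]
  have e : (-1 : ℤ) ^ (i : ℕ) • (ExteriorAlgebra.ι ℝ (Matrix.vecCons v (i.removeNth w) 0) *
      ExteriorAlgebra.ιMulti ℝ m (Matrix.vecTail (Matrix.vecCons v (i.removeNth w)))) =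
      (-1 : ℝ) ^ (i : ℕ) • (ExteriorAlgebra.ι ℝ v *
        ExteriorAlgebra.ιMulti ℝ m (i.removeNth w)) := by
    rw [← Int.cast_smul_eq_zsmul ℝ]
    simp [Matrix.tail_cons]
  rw [e, smul_mul_assoc, smul_smul, ← pow_add, mul_assoc]
  congr 2
  have := i.2
  omega

theorem coe_oneEquiv_symm (v : V) :
    (((exteriorPower.oneEquiv ℝ V).symm v : ⋀[ℝ]^1 V) : ExteriorAlgebra ℝ V) =
      ExteriorAlgebra.ι ℝ v := by
  have : (exteriorPower.oneEquiv ℝ V).symm v = exteriorPower.ιMulti ℝ 1 (fun _ ↦ v) := by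
    rw [LinearEquiv.symm_apply_eq, exteriorPower.oneEquiv_ιMulti]
  rw [this]
  simp [ExteriorAlgebra.ιMulti_apply]

theorem append_update_left {α : Type*} {m b : ℕ} (u : Fin m → α) (v : Fin b → α) (i : Fin m)
    (a : α) :
    Fin.append (Function.update u i a) v =
      Function.update (Fin.append u v) (Fin.castAdd b i) a := by
  ext j
  refine Fin.addCases (fun j ↦ ?_) (fun j ↦ ?_) j
  · by_cases hj : j = i <;> simp [hj]
  · have : Fin.natAdd m j ≠ Fin.castAdd b i := by
      intro h
      have := congrArg Fin.val h
      simp at this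
      omega
    simp [this]

variable [FiniteDimensional ℝ V]

/-! ### The inner product on exterior powers and the Hodge star -/

theorem inner_blade_blade {m : ℕ} (u v : Fin m → V) :
    inner ℝ (blade u) (blade v) = (Matrix.of fun i j ↦ (inner ℝ (u j) (v i) : ℝ)).det :=
  exteriorPower.inner_ιMulti_ιMulti u v

theorem norm_blade_sq {m : ℕ} (v : Fin m → V) : ‖blade v‖ ^ 2 = (Matrix.gram ℝ v).det := by
  rw [← real_inner_self_eq_norm_sq]
  exact exteriorPower.inner_ιMulti_self v

/-- Under the identification `Λ¹V = V` the inner product of `Λ¹V` is that of `V`. -/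
theorem inner_oneEquiv (x : ⋀[ℝ]^1 V) (v : V) :
    inner ℝ (exteriorPower.oneEquiv ℝ V x) v =
      inner ℝ x ((exteriorPower.oneEquiv ℝ V).symm v) := by
  have h (w : V) : (exteriorPower.oneEquiv ℝ V).symm w = blade (fun _ : Fin 1 ↦ w) := by
    rw [LinearEquiv.symm_apply_eq]
    exact (exteriorPower.oneEquiv_ιMulti (R := ℝ) (M := V) fun _ ↦ w).symm
  obtain ⟨u, rfl⟩ := (exteriorPower.oneEquiv ℝ V).symm.surjective x
  rw [h, h, inner_blade_blade, ← h]
  simp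

/-- As `Λⁿ V` is a line, the coefficient of `η` along a unit vector is `± ‖η‖`. -/
theorem inner_sq_eq_norm_sq {n : ℕ} (hn : Module.finrank ℝ V = n) {μ : ⋀[ℝ]^n V} (hμ : ‖μ‖ = 1)
    (η : ⋀[ℝ]^n V) : (inner ℝ μ η : ℝ) ^ 2 = ‖η‖ ^ 2 := by
  have h1 : Module.finrank ℝ (⋀[ℝ]^n V) = 1 := by
    rw [exteriorPower.finrank_eq, hn, Nat.choose_self]
  have hμ0 : μ ≠ 0 := by
    rintro rfl
    simp at hμ
  obtain ⟨c, rfl⟩ := (finrank_eq_one_iff_of_nonzero' μ hμ0).1 h1 η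
  rw [real_inner_smul_right, real_inner_self_eq_norm_sq, norm_smul, hμ]
  simp

theorem coe_orthonormalBasis_exteriorPower {I : Type*} [Fintype I] [LinearOrder I]
    (e : OrthonormalBasis I ℝ V) (a : ℕ) (s : Set.powersetCard I a) :
    ((e.exteriorPower a s : ⋀[ℝ]^a V) : ExteriorAlgebra ℝ V) =
      ExteriorAlgebra.ιMulti_family ℝ a e s := by
  rw [← OrthonormalBasis.coe_toBasis, OrthonormalBasis.toBasis_exteriorPower,
    exteriorPower.coe_basis, OrthonormalBasis.coe_toBasis]
  rfl

/-- The Hodge star belonging to a unit volume element is isometric: it maps the orthonormal basis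
`e_S` to `± e_{Sᶜ}`. -/
theorem inner_hodgeStar_hodgeStar {n a b : ℕ} (hn : Module.finrank ℝ V = n) {μ : ⋀[ℝ]^n V}
    (hμ : ‖μ‖ = 1) (h : a + b = n) (α β : ⋀[ℝ]^a V) :
    inner ℝ (hodgeStar μ h α) (hodgeStar μ h β) = inner ℝ α β := by
  subst h
  let e : OrthonormalBasis (Fin (a + b)) ℝ V := (stdOrthonormalBasis ℝ V).reindex (finCongr hn)
  have h0 (s : Set.powersetCard (Fin (a + b)) a) (r : Set.powersetCard (Fin (a + b)) b)
      (hsr : ¬ Disjoint s.val r.val) :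
      inner ℝ (hodgeStar μ rfl (e.exteriorPower a s)) (e.exteriorPower b r) = (0 : ℝ) := by
    have : wedge rfl (e.exteriorPower a s) (e.exteriorPower b r) = 0 := by
      ext
      rw [coe_wedge, coe_orthonormalBasis_exteriorPower, coe_orthonormalBasis_exteriorPower,
        ExteriorAlgebra.ιMulti_family_mul_of_not_disjoint _ _ _ _ hsr]
      rfl
    rw [inner_hodgeStar, this, inner_zero_right]
  have h1 (s : Set.powersetCard (Fin (a + b)) a) (r : Set.powersetCard (Fin (a + b)) b)
      (hsr : Disjoint s.val r.val) :
      (inner ℝ (hodgeStar μ rfl (e.exteriorPower a s)) (e.exteriorPower b r) : ℝ) ^ 2 = 1 := by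
    have : wedge rfl (e.exteriorPower a s) (e.exteriorPower b r) =
        (Set.powersetCard.permOfDisjoint hsr).sign •
          e.exteriorPower (a + b) (Set.powersetCard.disjUnion hsr) := by
      ext
      rw [coe_wedge, coe_orthonormalBasis_exteriorPower, coe_orthonormalBasis_exteriorPower,
        ExteriorAlgebra.ιMulti_family_mul_of_disjoint _ _ _ _ hsr,
        ← coe_orthonormalBasis_exteriorPower]
      rfl
    rw [inner_hodgeStar, this, inner_sq_eq_norm_sq hn hμ]
    rcases Int.units_eq_one_or (Set.powersetCard.permOfDisjoint hsr).sign with h | h <;>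
      simp [h]
  have hcompl (s : Set.powersetCard (Fin (a + b)) a) (r : Set.powersetCard (Fin (a + b)) b)
      (hsr : Disjoint s.val r.val) : r.val = s.valᶜ := by
    refine Finset.eq_of_subset_of_card_le
      (fun i hi ↦ Finset.mem_compl.2 fun his ↦ Finset.disjoint_left.1 hsr his hi) ?_
    rw [Finset.card_compl, Set.powersetCard.card_eq, Set.powersetCard.card_eq]
    simp
  have hon : Orthonormal ℝ (hodgeStar μ rfl ∘ (e.exteriorPower a).toBasis) := by
    rw [orthonormal_iff_ite]
    intro s t
    simp only [Function.comp_apply, OrthonormalBasis.coe_toBasis]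
    rw [← (e.exteriorPower b).sum_inner_mul_inner]
    split_ifs with hst
    · subst hst
      let r : Set.powersetCard (Fin (a + b)) b := ⟨s.valᶜ, by
        simp [Set.powersetCard.mem_iff, Finset.card_compl, Set.powersetCard.card_eq]⟩
      rw [Finset.sum_eq_single r, real_inner_comm, ← sq]
      · rw [real_inner_comm]
        exact h1 s r disjoint_compl_right
      · intro r' _ hr'
        rw [h0 s r', zero_mul]
        exact fun hd ↦ hr' (Subtype.ext (hcompl s r' hd))
      · simp
    · refine Finset.sum_eq_zero fun r _ ↦ ?_
      by_cases hs : Disjoint s.val r.val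
      · by_cases ht : Disjoint t.val r.val
        · exact absurd (Subtype.ext (compl_injective ((hcompl s r hs).symm.trans (hcompl t r ht))))
            hst
        · rw [real_inner_comm (hodgeStar μ rfl _), h0 t r ht, mul_zero]
      · rw [h0 s r hs, zero_mul]
  exact ((hodgeStar μ rfl).isometryOfOrthonormal
    (v := (e.exteriorPower a).toBasis) (by
      rw [OrthonormalBasis.coe_toBasis]
      exact (e.exteriorPower a).orthonormal)
      hon).inner_map_map α β

end Exterior

/-! ### The particular solution at a point -/

section Pointwise

variable {V : Type*} [NormedAddCommGroup V] [InnerProductSpace ℝ V] [FiniteDimensional ℝ V]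
variable {n k p : ℕ}

/-- The two signs picked up by moving `v` into the slot of `Yᵢ` give `(-1)ⁿ⁻ⁱ`; what remains is a
product of the form `⟪μ, B' ∧ ⋆B⟫ = ⟪⋆B', ⋆B⟫ = ⟪B', B⟫`. -/
theorem inner_theta (hn : Module.finrank ℝ V = n) (hkp : k + p ≤ n) {μ : ⋀[ℝ]^n V} (hμ : ‖μ‖ = 1)
    (X : Fin k → V) (Y : Fin p → V) (i : Fin p) (v : V) :
    inner ℝ (theta hkp μ X Y i) v = (-1 : ℝ) ^ (n - ((i : ℕ) + 1)) *
      inner ℝ (blade (Function.update (Fin.append Y X) (Fin.castAdd k i) v))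
        (blade (Fin.append Y X)) := by
  have hpk : p + (k + (n - (p + k))) = n := by omega
  set β := hodgeStar μ (show (p + k) + (n - (p + k)) = n by omega) (blade (Fin.append Y X)) with hβ
  have key : wedge (show (n - 1) + 1 = n by have := i.pos; omega)
      (wedge (show ((p - 1) + k) + (n - (p + k)) = n - 1 by have := i.pos; omega)
        (wedge rfl (bladeOmit Y i) (blade X)) β) ((exteriorPower.oneEquiv ℝ V).symm v) =
      (-1 : ℝ) ^ (n - ((i : ℕ) + 1)) •
        wedge (show (p + k) + (n - (p + k)) = n by omega)
          (blade (Function.update (Fin.append Y X) (Fin.castAdd k i) v)) β := by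
    refine Subtype.ext ?_
    have := bladeOmit_mul_ι hpk Y i (wedge rfl (blade X) β) v
    rw [coe_wedge, ← mul_assoc, ← mul_assoc] at this
    rw [← append_update_left, ← wedge_blade_blade]
    simpa only [coe_wedge, coe_oneEquiv_symm, Submodule.coe_smul] using this
  rw [theta, inner_oneEquiv, inner_hodgeStar, wedge_blade_blade, ← hβ, key,
    real_inner_smul_right, ← inner_hodgeStar, hβ, inner_hodgeStar_hodgeStar hn hμ]

/-- By Cramer's rule, the Gram determinant expressing `⟪Θᵢ, v⟫` expands along the column of `v`. So
up to sign, `Θᵢ` is the combination of the given vectors whose coefficients form the `i`-th row of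
the adjugate of their Gram matrix; in particular `Θᵢ` does not depend on the choice of `μ`. -/
theorem neg_one_pow_smul_theta (hn : Module.finrank ℝ V = n) (hkp : k + p ≤ n) {μ : ⋀[ℝ]^n V}
    (hμ : ‖μ‖ = 1) (X : Fin k → V) (Y : Fin p → V) (i : Fin p) :
    (-1 : ℝ) ^ (n - ((i : ℕ) + 1)) • theta hkp μ X Y i =
      ∑ j, (Matrix.gram ℝ (Fin.append Y X)).adjugate (Fin.castAdd k i) j • Fin.append Y X j := by
  refine ext_inner_right ℝ fun v ↦ ?_
  rw [real_inner_smul_left, inner_theta hn hkp hμ, ← mul_assoc, ← pow_add,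
    Even.neg_one_pow ⟨_, rfl⟩, one_mul, inner_blade_blade, sum_inner]
  set w := Fin.append Y X
  have h : (Matrix.of fun a b ↦
      (inner ℝ (Function.update w (Fin.castAdd k i) v b) (w a) : ℝ)) =
      (Matrix.gram ℝ w).updateCol (Fin.castAdd k i) (fun j ↦ inner ℝ (w j) v) := by
    ext a b
    by_cases hb : b = Fin.castAdd k i
    · subst hb
      simp [real_inner_comm]
    · simp [hb, real_inner_comm, Matrix.gram_apply]
  rw [h, ← Matrix.cramer_apply, Matrix.cramer_eq_adjugate_mulVec]
  simp [Matrix.mulVec, dotProduct, real_inner_smul_left]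

/-- `X₀` in terms of the Gram matrix of the given vectors. -/
theorem particularSolution_eq (hn : Module.finrank ℝ V = n) (hkp : k + p ≤ n) {μ : ⋀[ℝ]^n V}
    (hμ : ‖μ‖ = 1) (X : Fin k → V) (Y : Fin p → V) (h : Fin p → ℝ) :
    particularSolution hkp μ X Y h = ∑ i : Fin p, ∑ j : Fin (p + k),
      ((Matrix.gram ℝ (Fin.append Y X)).det⁻¹ * h i *
        (Matrix.gram ℝ (Fin.append Y X)).adjugate (Fin.castAdd k i) j) • Fin.append Y X j := by
  rw [particularSolution, wedge_blade_blade, zpow_neg, ← norm_blade_sq, Finset.smul_sum]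
  refine Finset.sum_congr rfl fun i _ ↦ ?_
  rw [mul_comm ((-1 : ℝ) ^ _), mul_smul, neg_one_pow_smul_theta hn hkp hμ, smul_smul,
    Finset.smul_sum]
  simp only [smul_smul]
  rfl

/-- The coefficients of `X₀` are the rows of the inverse Gram matrix belonging to the `Yᵢ`, weighted
by the `hᵢ`, so `X₀` has the prescribed products with all given vectors. -/
theorem inner_particularSolution (hn : Module.finrank ℝ V = n) (hkp : k + p ≤ n) {μ : ⋀[ℝ]^n V}
    (hμ : ‖μ‖ = 1) (X : Fin k → V) (Y : Fin p → V) (h : Fin p → ℝ)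
    (hli : LinearIndependent ℝ (Fin.append Y X)) (m : Fin (p + k)) :
    inner ℝ (particularSolution hkp μ X Y h) (Fin.append Y X m) =
      Fin.append h (fun _ ↦ 0) m := by
  rw [particularSolution_eq hn hkp hμ]
  set w := Fin.append Y X
  have hdet : (Matrix.gram ℝ w).det ≠ 0 := Matrix.det_gram_ne_zero_iff_linearIndependent.2 hli
  have hadj (i : Fin p) : ∑ j, (Matrix.gram ℝ w).adjugate (Fin.castAdd k i) j *
      (inner ℝ (w j) (w m) : ℝ) = if Fin.castAdd k i = m then (Matrix.gram ℝ w).det else 0 := by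
    have := congrFun (congrFun (Matrix.adjugate_mul (Matrix.gram ℝ w)) (Fin.castAdd k i)) m
    rw [Matrix.mul_apply] at this
    simpa [Matrix.one_apply, Matrix.gram_apply] using this
  simp only [sum_inner, real_inner_smul_left, mul_assoc]
  simp only [← Finset.mul_sum, hadj]
  refine Fin.addCases (fun m ↦ ?_) (fun m ↦ ?_) m
  · simp [Fin.castAdd_inj, hdet, mul_comm]
  · have hne (i : Fin p) : Fin.castAdd k i ≠ Fin.natAdd p m := fun hi ↦ by
      have := congrArg Fin.val hi
      simp at this
      omega
    simp [hne]

omit [FiniteDimensional ℝ V] in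
theorem linearIndependent_append_iff {a b : ℕ} (u : Fin a → V) (v : Fin b → V) :
    LinearIndependent ℝ (Fin.append u v) ↔ LinearIndependent ℝ (Sum.elim u v) := by
  rw [← linearIndependent_equiv finSumFinEquiv]
  have : Fin.append u v ∘ finSumFinEquiv = Sum.elim u v := by
    ext (i | i) <;> simp
  rw [this]

omit [FiniteDimensional ℝ V] in
theorem linearIndependent_append_of_sumElim {X : Fin k → V} {Y : Fin p → V}
    (hli : LinearIndependent ℝ (Sum.elim X Y)) : LinearIndependent ℝ (Fin.append Y X) := by
  rw [linearIndependent_append_iff, ← linearIndependent_equiv (Equiv.sumComm _ _)]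
  convert hli using 1
  ext (i | i) <;> simp

omit [FiniteDimensional ℝ V] in
theorem mem_orthogonal_span_range_union_iff {ι κ : Type*} (X : ι → V) (Y : κ → V) (v : V) :
    v ∈ (Submodule.span ℝ (Set.range X ∪ Set.range Y))ᗮ ↔
      (∀ l, inner ℝ v (X l) = 0) ∧ ∀ i, inner ℝ v (Y i) = 0 := by
  rw [Submodule.mem_orthogonal']
  constructor
  · exact fun h ↦ ⟨fun l ↦ h _ (Submodule.subset_span (.inl ⟨l, rfl⟩)),
      fun i ↦ h _ (Submodule.subset_span (.inr ⟨i, rfl⟩))⟩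
  · rintro ⟨hX, hY⟩ u hu
    induction hu using Submodule.span_induction with
    | mem u hu => rcases hu with ⟨l, rfl⟩ | ⟨i, rfl⟩ <;> simp [hX, hY]
    | zero => simp
    | add u w _ _ hu hw => rw [inner_add_right, hu, hw, add_zero]
    | smul c u _ hu => rw [real_inner_smul_right, hu, mul_zero]

/-- The system of equations is affine, with `X₀` as one solution and the orthogonal complement of
the given vectors as its space of directions. -/
theorem solution_iff (hn : Module.finrank ℝ V = n) (hkp : k + p ≤ n) {μ : ⋀[ℝ]^n V}
    (hμ : ‖μ‖ = 1) (X : Fin k → V) (Y : Fin p → V) (h : Fin p → ℝ)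
    (hli : LinearIndependent ℝ (Sum.elim X Y)) (v : V) :
    ((∀ l, inner ℝ v (X l) = 0) ∧ ∀ i, inner ℝ v (Y i) = h i) ↔
      v - particularSolution hkp μ X Y h ∈
        (Submodule.span ℝ (Set.range X ∪ Set.range Y))ᗮ := by
  have hli' := linearIndependent_append_of_sumElim hli
  have hX (l) : inner ℝ (particularSolution hkp μ X Y h) (X l) = (0 : ℝ) := by
    simpa using inner_particularSolution hn hkp hμ X Y h hli' (Fin.natAdd p l)
  have hY (i) : inner ℝ (particularSolution hkp μ X Y h) (Y i) = h i := by
    simpa using inner_particularSolution hn hkp hμ X Y h hli' (Fin.castAdd k i)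
  rw [mem_orthogonal_span_range_union_iff]
  simp only [inner_sub_left, hX, hY, sub_eq_zero, sub_zero]

/-! ### Generators of the orthogonal complement -/

theorem inner_perpGenerator (hkp : k + p ≤ n) (μ : ⋀[ℝ]^n V) (X : Fin k → V) (Y : Fin p → V)
    (Z : Fin (n - (k + p)) → V) (a : Fin (n - (k + p))) (v : V) :
    inner ℝ (perpGenerator μ X Y Z a) v = (-1 : ℝ) ^ (n - ((a : ℕ) + 1)) *
      inner ℝ μ (wedge (show (n - (k + p)) + (p + k) = n by omega)
        (blade (Function.update Z a v)) (blade (Fin.append Y X))) := by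
  have key : wedge (show (n - 1) + 1 = n by have := a.pos; omega)
      (wedge (show ((n - (k + p) - 1) + p) + k = n - 1 by have := a.pos; omega)
        (wedge rfl (bladeOmit Z a) (blade Y)) (blade X)) ((exteriorPower.oneEquiv ℝ V).symm v) =
      (-1 : ℝ) ^ (n - ((a : ℕ) + 1)) •
        wedge (show (n - (k + p)) + (p + k) = n by omega)
          (blade (Function.update Z a v)) (blade (Fin.append Y X)) := by
    refine Subtype.ext ?_
    have := bladeOmit_mul_ι (show (n - (k + p)) + (p + k) = n by omega) Z a
      (blade (Fin.append Y X)) v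
    rw [← wedge_blade_blade Y X, coe_wedge, ← mul_assoc] at this
    rw [← wedge_blade_blade Y X]
    simpa only [coe_wedge, coe_oneEquiv_symm, Submodule.coe_smul, mul_assoc] using this
  rw [perpGenerator, inner_oneEquiv, inner_hodgeStar, key, real_inner_smul_right]

/-- The product with a generator is, up to sign, the coefficient along `μ` of an `n`-fold exterior
product, whose square is a Gram determinant. -/
theorem inner_perpGenerator_eq_zero_iff (hn : Module.finrank ℝ V = n) (hkp : k + p ≤ n)
    {μ : ⋀[ℝ]^n V} (hμ : ‖μ‖ = 1) (X : Fin k → V) (Y : Fin p → V)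
    (Z : Fin (n - (k + p)) → V) (a : Fin (n - (k + p))) (v : V) :
    inner ℝ (perpGenerator μ X Y Z a) v = (0 : ℝ) ↔
      ¬ LinearIndependent ℝ (Fin.append (Function.update Z a v) (Fin.append Y X)) := by
  rw [inner_perpGenerator hkp, mul_eq_zero, or_iff_right (pow_ne_zero _ (by norm_num)),
    ← sq_eq_zero_iff, inner_sq_eq_norm_sq hn hμ]
  have : ‖wedge (show (n - (k + p)) + (p + k) = n by omega) (blade (Function.update Z a v))
      (blade (Fin.append Y X))‖ ^ 2 =
        (Matrix.gram ℝ (Fin.append (Function.update Z a v) (Fin.append Y X))).det := by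
    -- The degree is generalized so that it can be replaced by the sum of the two lengths.
    have aux {c : ℕ} (hc : (n - (k + p)) + (p + k) = c) :
        ‖wedge hc (blade (Function.update Z a v)) (blade (Fin.append Y X))‖ ^ 2 =
          (Matrix.gram ℝ (Fin.append (Function.update Z a v) (Fin.append Y X))).det := by
      subst hc
      rw [wedge_blade_blade, norm_blade_sq]
    exact aux _
  rw [this, ← Matrix.det_gram_ne_zero_iff_linearIndependent (𝕜 := ℝ), not_not]

/-- If the `Z_a` complete `X`, `Y` to a basis, the generators are orthogonal to `X` and `Y`, and
biorthogonal to the `Z_a` up to non-zero factors. A vector orthogonal to `X` and `Y` is therefore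
determined by its products with the `Z_a`, and equals the corresponding combination of the
generators. -/
theorem orthogonal_eq_span_perpGenerator (hn : Module.finrank ℝ V = n) (hkp : k + p ≤ n)
    {μ : ⋀[ℝ]^n V} (hμ : ‖μ‖ = 1) (X : Fin k → V) (Y : Fin p → V) (Z : Fin (n - (k + p)) → V)
    (hli : LinearIndependent ℝ (Sum.elim (Sum.elim X Y) Z))
    (hsp : ⊤ ≤ Submodule.span ℝ (Set.range (Sum.elim (Sum.elim X Y) Z))) :
    (Submodule.span ℝ (Set.range X ∪ Set.range Y))ᗮ =
      Submodule.span ℝ (Set.range (perpGenerator μ X Y Z)) := by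
  have hXY (a : Fin (n - (k + p))) (j : Fin (p + k)) :
      inner ℝ (perpGenerator μ X Y Z a) (Fin.append Y X j) = (0 : ℝ) := by
    rw [inner_perpGenerator_eq_zero_iff hn hkp hμ]
    intro h
    have : Fin.castAdd (p + k) a = Fin.natAdd _ j := h.injective (by simp)
    have := congrArg Fin.val this
    simp at this
    omega
  have hX (a) (l) : inner ℝ (perpGenerator μ X Y Z a) (X l) = (0 : ℝ) := by
    simpa using hXY a (Fin.natAdd p l)
  have hY (a) (i) : inner ℝ (perpGenerator μ X Y Z a) (Y i) = (0 : ℝ) := by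
    simpa using hXY a (Fin.castAdd k i)
  have hZ (a b) (hab : a ≠ b) : inner ℝ (perpGenerator μ X Y Z a) (Z b) = (0 : ℝ) := by
    rw [inner_perpGenerator_eq_zero_iff hn hkp hμ]
    intro h
    have : Fin.castAdd (p + k) a = Fin.castAdd (p + k) b :=
      h.injective (by simp [Function.update_of_ne hab.symm])
    exact hab (Fin.castAdd_injective _ _ this)
  have hZZ (a) : inner ℝ (perpGenerator μ X Y Z a) (Z a) ≠ (0 : ℝ) := by
    rw [Ne, inner_perpGenerator_eq_zero_iff hn hkp hμ, not_not, Function.update_eq_self,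
      linearIndependent_append_iff]
    rw [← linearIndependent_equiv ((Equiv.sumComm _ _).trans
      ((Equiv.refl _).sumCongr ((Equiv.sumComm _ _).trans finSumFinEquiv)))]
    convert hli using 1
    ext ((i | i) | i) <;> simp
  apply le_antisymm
  · intro v hv
    rw [mem_orthogonal_span_range_union_iff] at hv
    have hv' : v = ∑ a, (inner ℝ v (Z a) / inner ℝ (perpGenerator μ X Y Z a) (Z a) : ℝ) •
        perpGenerator μ X Y Z a := by
      rw [← sub_eq_zero, ← inner_self_eq_zero (𝕜 := ℝ)]
      generalize hu : v - _ = u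
      have hmem : u ∈ (Submodule.span ℝ (Set.range (Sum.elim X Y) ∪ Set.range Z))ᗮ := by
        rw [mem_orthogonal_span_range_union_iff, ← hu]
        simp only [inner_sub_left, sum_inner, real_inner_smul_left]
        refine ⟨?_, fun b ↦ ?_⟩
        · rintro (l | i) <;> simp [hX, hY, hv.1, hv.2]
        · rw [Finset.sum_eq_single b (fun a _ hab ↦ by rw [hZ a b hab, mul_zero]) (by simp),
            div_mul_cancel₀ _ (hZZ b), sub_self]
      rw [← Set.Sum.elim_range] at hmem
      exact Submodule.mem_orthogonal' _ _ |>.1 hmem u (hsp trivial)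
    rw [hv']
    exact Submodule.sum_mem _ fun a _ ↦ Submodule.smul_mem _ _ (Submodule.subset_span ⟨a, rfl⟩)
  · rw [Submodule.span_le]
    rintro _ ⟨a, rfl⟩
    exact (mem_orthogonal_span_range_union_iff ..).2 ⟨hX a, hY a⟩

/-- The vectors completing the family are taken from the orthogonal complement of its span. -/
theorem exists_linearIndependent_sumElim {ι : Type*} [Fintype ι] (w : ι → V)
    (hw : LinearIndependent ℝ w) {m : ℕ} (hm : Fintype.card ι + m = Module.finrank ℝ V) :
    ∃ z : Fin m → V, LinearIndependent ℝ (Sum.elim w z) := by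
  set W := Submodule.span ℝ (Set.range w)
  have h1 : Module.finrank ℝ Wᗮ = m := by
    have := W.finrank_add_finrank_orthogonal
    rw [finrank_span_eq_card hw] at this
    omega
  let b := Module.finBasisOfFinrankEq ℝ Wᗮ h1
  refine ⟨fun a ↦ b a, hw.sum_type
    (b.linearIndependent.map' Wᗮ.subtype (Submodule.ker_subtype _)) ?_⟩
  refine W.orthogonal_disjoint.mono_right (Submodule.span_le.2 ?_)
  rintro _ ⟨a, rfl⟩
  exact (b a).2

end Pointwise

/-! ### Smoothness and moving frames -/

section Manifold

open Topology

variable {n : ℕ} {M : Type*} [TopologicalSpace M] [ChartedSpace (EuclideanSpace ℝ (Fin n)) M]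

theorem contMDiffOn_det {ι : Type*} [Fintype ι] [DecidableEq ι] {A : M → Matrix ι ι ℝ} {U : Set M}
    (hA : ∀ i j, ContMDiffOn (𝓡 n) 𝓘(ℝ) ∞ (fun x ↦ A x i j) U) :
    ContMDiffOn (𝓡 n) 𝓘(ℝ) ∞ (fun x ↦ (A x).det) U := by
  simp only [Matrix.det_apply']
  exact contMDiffOn_finsetSum fun σ _ ↦ contMDiffOn_const.mul
    (contMDiffOn_finsetProd fun i _ ↦ hA _ _)

theorem contMDiffOn_adjugate {ι : Type*} [Fintype ι] [DecidableEq ι] {A : M → Matrix ι ι ℝ}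
    {U : Set M} (hA : ∀ i j, ContMDiffOn (𝓡 n) 𝓘(ℝ) ∞ (fun x ↦ A x i j) U) (i j : ι) :
    ContMDiffOn (𝓡 n) 𝓘(ℝ) ∞ (fun x ↦ (A x).adjugate i j) U := by
  simp only [Matrix.adjugate_apply]
  refine contMDiffOn_det fun a b ↦ ?_
  simp only [Matrix.updateRow_apply]
  split_ifs
  · exact contMDiffOn_const
  · exact hA a b

variable [IsManifold (𝓡 n) ∞ M]
    [Bundle.RiemannianBundle (fun x : M ↦ TangentSpace (𝓡 n) x)]
    [IsContMDiffRiemannianBundle (𝓡 n) ∞ (EuclideanSpace ℝ (Fin n))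
      (fun x : M ↦ TangentSpace (𝓡 n) x)]

omit [IsManifold (𝓡 n) ∞ M] [IsContMDiffRiemannianBundle (𝓡 n) ∞ (EuclideanSpace ℝ (Fin n))
  (fun x : M ↦ TangentSpace (𝓡 n) x)] in
/-- The vector space structure in the statement is the one underlying the inner product `g_x`. It
is definitionally that of the tangent space, but naming it spares the unifier from finding this out
inside larger terms. -/
theorem finrank_tangentSpace (x : M) :
    @Module.finrank ℝ (TangentSpace (𝓡 n) x) _ _ (Bundle.instInnerProductSpaceReal
      (E := fun x : M ↦ TangentSpace (𝓡 n) x) x).toModule = n :=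
  finrank_euclideanSpace_fin (𝕜 := ℝ) (n := n)

theorem contMDiffOn_gram {ι : Type*} {s : ι → (x : M) → TangentSpace (𝓡 n) x} {U : Set M}
    (hs : ∀ i, IsSmoothFieldOn (s i) U) (i j : ι) :
    ContMDiffOn (𝓡 n) 𝓘(ℝ) ∞ (fun x ↦ Matrix.gram ℝ (s · x) i j) U :=
  (hs i).inner_bundle (hs j)

/-- Smoothness can be read off from the expression of `X₀` by the Gram matrix, which does not
involve the (possibly discontinuous) choice of volume elements. -/
theorem isSmoothFieldOn_particularField {k p : ℕ} (hkp : k + p ≤ n) {U : Set M}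
    {μ : (x : M) → ⋀[ℝ]^n (TangentSpace (𝓡 n) x)} (hμ : ∀ x ∈ U, ‖μ x‖ = 1)
    {h : Fin p → M → ℝ} (hh : ∀ i, ContMDiffOn (𝓡 n) 𝓘(ℝ) ∞ (h i) U)
    {X : Fin k → (x : M) → TangentSpace (𝓡 n) x} (hX : ∀ l, IsSmoothFieldOn (X l) U)
    {Y : Fin p → (x : M) → TangentSpace (𝓡 n) x} (hY : ∀ i, IsSmoothFieldOn (Y i) U)
    (hXY : ∀ x ∈ U, LinearIndependent ℝ (Sum.elim (fun l ↦ X l x) (fun i ↦ Y i x))) :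
    IsSmoothFieldOn (particularField hkp μ X Y h) U := by
  set w : Fin (p + k) → (x : M) → TangentSpace (𝓡 n) x := Fin.append Y X with hw
  have hwx (x : M) : Fin.append (fun i ↦ Y i x) (fun l ↦ X l x) = (w · x) := by
    ext j
    refine Fin.addCases (fun i ↦ ?_) (fun l ↦ ?_) j <;> simp [hw]
  have hws (j) : IsSmoothFieldOn (w j) U := by
    refine Fin.addCases (fun i ↦ ?_) (fun l ↦ ?_) j
    · simpa [hw] using hY i
    · simpa [hw] using hX l
  have hdet (x) (hx : x ∈ U) : (Matrix.gram ℝ (w · x)).det ≠ 0 := by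
    rw [Matrix.det_gram_ne_zero_iff_linearIndependent, ← hwx]
    exact linearIndependent_append_of_sumElim (hXY x hx)
  have key : IsSmoothFieldOn (fun x ↦ ∑ i : Fin p, ∑ j : Fin (p + k),
      ((Matrix.gram ℝ (w · x)).det⁻¹ * h i x *
        (Matrix.gram ℝ (w · x)).adjugate (Fin.castAdd k i) j) • w j x) U := by
    refine ContMDiffOn.sum_section fun i _ ↦ ContMDiffOn.sum_section fun j _ ↦
      ContMDiffOn.smul_section ?_ (hws j)
    exact (((contMDiffOn_det (contMDiffOn_gram hws)).inv₀ hdet).mul (hh i)).mul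
      (contMDiffOn_adjugate (contMDiffOn_gram hws) _ _)
  refine ContMDiffOn.congr key fun x hx ↦ ?_
  refine congrArg (fun v ↦ (⟨x, v⟩ : TangentBundle (𝓡 n) M)) ?_
  have := particularSolution_eq (finrank_tangentSpace x) hkp (hμ x hx) (fun l ↦ X l x)
    (fun i ↦ Y i x) (fun i ↦ h i x)
  rw [hwx] at this
  exact this

/-- The given fields are completed at a single point; extending the new vectors smoothly gives a
frame wherever the Gram determinant does not vanish, which is an open condition. -/
theorem exists_isLocalFrameOn {ι : Type*} [Fintype ι] {m : ℕ} (hm : Fintype.card ι + m = n)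
    {U : Set M} (hU : IsOpen U) {w : ι → (x : M) → TangentSpace (𝓡 n) x}
    (hw : ∀ i, IsSmoothFieldOn (w i) U) {x : M} (hx : x ∈ U)
    (hli : LinearIndependent ℝ (w · x)) :
    ∃ O : Set M, IsOpen O ∧ x ∈ O ∧ O ⊆ U ∧ ∃ Z : Fin m → (x : M) → TangentSpace (𝓡 n) x,
      IsLocalFrameOn (𝓡 n) (EuclideanSpace ℝ (Fin n)) ∞ (Sum.elim w Z) O := by
  classical
  obtain ⟨z, hz⟩ := exists_linearIndependent_sumElim (w · x) hli
    (hm.trans (finrank_tangentSpace x).symm)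
  set Z : Fin m → (y : M) → TangentSpace (𝓡 n) y :=
    fun a ↦ FiberBundle.extend (EuclideanSpace ℝ (Fin n)) (z a) with hZ
  have hex (a : Fin m) : ∃ s ∈ 𝓝 x, IsSmoothFieldOn (Z a) s :=
    FiberBundle.exists_contMDiffOn_extend (𝓡 n) (EuclideanSpace ℝ (Fin n)) (z a)
  choose s hs hsZ using hex
  set O₁ := interior (U ∩ ⋂ a, s a) with hO₁
  have hxO₁ : x ∈ O₁ := mem_interior_iff_mem_nhds.2
    (Filter.inter_mem (hU.mem_nhds hx) (Filter.iInter_mem.2 hs))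
  have hsm (i) : IsSmoothFieldOn (Sum.elim w Z i) O₁ := by
    rcases i with i | a
    · exact (hw i).mono fun y hy ↦ (interior_subset hy).1
    · exact (hsZ a).mono fun y hy ↦ Set.mem_iInter.1 (interior_subset hy).2 a
  have hdet := contMDiffOn_det (contMDiffOn_gram hsm)
  refine ⟨O₁ ∩ (fun y ↦ (Matrix.gram ℝ (Sum.elim w Z · y)).det) ⁻¹' {0}ᶜ,
    hdet.continuousOn.isOpen_inter_preimage isOpen_interior isOpen_compl_singleton,
    ⟨hxO₁, ?_⟩, fun y hy ↦ (interior_subset hy.1).1, Z, ?_⟩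
  · rw [Set.mem_preimage, Set.mem_compl_singleton_iff,
      Matrix.det_gram_ne_zero_iff_linearIndependent]
    have hZx : (Sum.elim w Z · x) = Sum.elim (w · x) z := by
      ext1 (i | a)
      · rfl
      · simp [hZ]
    rw [hZx]
    exact hz
  · have hLI {y} (hy : y ∈ O₁ ∩ (fun y ↦ (Matrix.gram ℝ (Sum.elim w Z · y)).det) ⁻¹' {0}ᶜ) :
        LinearIndependent ℝ (Sum.elim w Z · y) :=
      Matrix.det_gram_ne_zero_iff_linearIndependent.1 hy.2
    refine ⟨hLI, fun {y} hy ↦ ?_, fun i ↦ (hsm i).mono Set.inter_subset_left⟩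
    refine ((hLI hy).span_eq_top_of_card_eq_finrank' ?_).ge
    exact (by simpa using hm : Fintype.card (ι ⊕ Fin m) = n).trans (finrank_tangentSpace y).symm

end Manifold

end HodgeSystem

theorem theorem3p1
    {n : ℕ} {M : Type*} [TopologicalSpace M] [ChartedSpace (EuclideanSpace ℝ (Fin n)) M]
    [IsManifold (𝓡 n) ∞ M]
    [Bundle.RiemannianBundle (fun x : M ↦ TangentSpace (𝓡 n) x)]
    [IsContMDiffRiemannianBundle (𝓡 n) ∞ (EuclideanSpace ℝ (Fin n))
      (fun x : M ↦ TangentSpace (𝓡 n) x)]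
    {k p : ℕ} (hk : 0 < k) (hp : 1 < p) (hkp : k + p < n - 1)
    (U : Set M) (hU : IsOpen U)
    (μ : (x : M) → ⋀[ℝ]^n (TangentSpace (𝓡 n) x)) (hμ : ∀ x ∈ U, ‖μ x‖ = 1)
    (h : Fin p → M → ℝ) (hh : ∀ i, ContMDiffOn (𝓡 n) 𝓘(ℝ) ∞ (h i) U)
    (hh0 : ∀ i, ∃ x ∈ U, h i x ≠ 0)
    (X : Fin k → (x : M) → TangentSpace (𝓡 n) x) (hX : ∀ l, IsSmoothFieldOn (X l) U)
    (Y : Fin p → (x : M) → TangentSpace (𝓡 n) x) (hY : ∀ i, IsSmoothFieldOn (Y i) U)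
    (hXY : ∀ x ∈ U, LinearIndependent ℝ (Sum.elim (fun l ↦ X l x) (fun i ↦ Y i x))) :
    -- `X₀` is a smooth vector field on `U`
    IsSmoothFieldOn (particularField (show k + p ≤ n by omega) μ X Y h) U ∧
    -- the solutions in `𝔛(U)` are exactly the fields `X₀ + X_⊥`
    (∀ W : (x : M) → TangentSpace (𝓡 n) x, IsSmoothFieldOn W U →
      ((∀ x ∈ U, (∀ l, inner ℝ (W x) (X l x) = 0) ∧ (∀ i, inner ℝ (W x) (Y i x) = h i x)) ↔
        ∃ Wperp : (x : M) → TangentSpace (𝓡 n) x, IsSmoothFieldOn Wperp U ∧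
          (∀ x ∈ U, W x = particularField (show k + p ≤ n by omega) μ X Y h x + Wperp x) ∧
          ∀ x ∈ U, Wperp x ∈ perpSpace X Y x)) ∧
    -- around every point the given fields can be completed to a moving frame
    (∀ x ∈ U, ∃ O : Set M, IsOpen O ∧ x ∈ O ∧ O ⊆ U ∧
      ∃ Z : Fin (n - (k + p)) → (x : M) → TangentSpace (𝓡 n) x,
        IsLocalFrameOn (𝓡 n) (EuclideanSpace ℝ (Fin n)) ∞ (Sum.elim (Sum.elim X Y) Z) O) ∧
    -- for every such completion, the vectors orthogonal to the given fields, hence the values of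
    -- `X_⊥`, are the linear combinations of the Hodge star generators
    (∀ O : Set M, IsOpen O → O ⊆ U →
      ∀ Z : Fin (n - (k + p)) → (x : M) → TangentSpace (𝓡 n) x,
        IsLocalFrameOn (𝓡 n) (EuclideanSpace ℝ (Fin n)) ∞ (Sum.elim (Sum.elim X Y) Z) O →
        ∀ x ∈ O, perpSpace X Y x = Submodule.span ℝ (Set.range
          (perpGenerator (μ x) (fun l ↦ X l x) (fun i ↦ Y i x) (fun a ↦ Z a x)))) := by
  have hkp' : k + p ≤ n := by omega
  have hsol (x) (hx : x ∈ U) := solution_iff (finrank_tangentSpace x) hkp' (hμ x hx)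
    (fun l ↦ X l x) (fun i ↦ Y i x) (fun i ↦ h i x) (hXY x hx)
  have hX₀ := isSmoothFieldOn_particularField hkp' hμ hh hX hY hXY
  refine ⟨hX₀, fun W hW ↦ ⟨fun hsys ↦ ?_, ?_⟩, fun x hx ↦ ?_, fun O _ hOU Z hZ x hx ↦ ?_⟩
  · exact ⟨fun x ↦ W x - particularField hkp' μ X Y h x, ContMDiffOn.sub_section hW hX₀,
      fun x _ ↦ (add_sub_cancel _ _).symm, fun x hx ↦ (hsol x hx _).1 (hsys x hx)⟩
  · rintro ⟨Wperp, -, hdecomp, hperp⟩ x hx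
    refine (hsol x hx _).2 ?_
    rw [hdecomp x hx, particularField, add_sub_cancel_left]
    exact hperp x hx
  · have hw (i) : IsSmoothFieldOn (Sum.elim X Y i) U := by
      rcases i with l | i
      · exact hX l
      · exact hY i
    have he : (Sum.elim X Y · x) = Sum.elim (X · x) (Y · x) := by
      ext1 (l | i) <;> rfl
    refine exists_isLocalFrameOn (by simp; omega) hU hw hx ?_
    rw [he]
    exact hXY x hx
  · have he : (Sum.elim (Sum.elim X Y) Z · x) =
        Sum.elim (Sum.elim (X · x) (Y · x)) (Z · x) := by
      ext1 ((l | i) | a) <;> rfl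
    refine orthogonal_eq_span_perpGenerator (finrank_tangentSpace x) hkp' (hμ x (hOU hx)) _ _ _
      ?_ ?_
    · rw [← he]
      exact hZ.linearIndependent hx
    · rw [← he]
      exact hZ.generating hx
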